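/- Let $n\ge 1$ and let $SB_n^+$ be the positive singular braid monoid, i.e. the monoid generated by $\sigma_i, x_i$ ($1\le i\le n-1$) subject to the relations $\sigma_i\sigma_j=\sigma_j\sigma_i$ and $x_ix_j=x_jx_i$ for $|i-j|>1$; $x_i\sigma_j=\sigma_jx_i$ for $|i-j|\ne 1$; and, for $1\le i\le n-2$, $\sigma_i\sigma_{i+1}\sigma_i=\sigma_{i+1}\sigma_i\sigma_{i+1}$, $\sigma_i\sigma_{i+1}x_i=x_{i+1}\sigma_i\sigma_{i+1}$, $\sigma_{i+1}\sigma_ix_{i+1}=x_i\sigma_{i+1}\sigma_i$. Words in the letters $\sigma_i,x_i$ are called positive words; write $A\doteq B$ if the positive words $A,B$ are equal in $SB_n^+$. Let $\Delta=\Pi_{n-1}\Pi_{n-2}\cdots\Pi_1$ with $\Pi_t=\sigma_1\sigma_2\cdots\sigma_t$. For a positive word $W$, the Cayley diagram $D(W)$ is the directed graph with labelled edges whose nodes are the elements of $SB_n^+$ represented by those positive words $P$ with $PQ\doteq W$ for some positive word $Q$, and which has an edge labelled by the letter $a$ from the node of $P$ to the node of $Pa$ whenever $PaQ\doteq W$ for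 some positive word $Q$. **Theorem.** If $W$ is a positive word with $W\doteq\Delta V$ for some positive word $V$, then for every node $c$ of $D(W)$ and every $i=1,\dots,n-1$, some edge of $D(W)$ labelled $\sigma_i$ starts or ends at $c$. -/

import Mathlib

/-- The letters `σ_1, …, σ_{n-1}, x_1, …, x_{n-1}`. The index `i : Fin (n - 1)` is zero-based:
`sigma i` is the letter with number `i + 1`, and likewise for `x i`. -/
inductive SingularLetter (n : ℕ) : Type
  | sigma (i : Fin (n - 1)) : SingularLetter n
  | x (i : Fin (n - 1)) : SingularLetter n

namespace SingularBraid

/-- Positive words in the letters `σ_i`, `x_i`. -/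
abbrev Word (n : ℕ) : Type := FreeMonoid (SingularLetter n)

/-- The one-letter word `σ_i`. -/
def σ {n : ℕ} (i : Fin (n - 1)) : Word n := FreeMonoid.of (SingularLetter.sigma i)

/-- The one-letter word `x_i`. -/
def χ {n : ℕ} (i : Fin (n - 1)) : Word n := FreeMonoid.of (SingularLetter.x i)

/-- The defining relations of the positive singular braid monoid. -/
inductive Rel (n : ℕ) : Word n → Word n → Prop
  | sigma_comm (i j : Fin (n - 1)) (h : 1 < |(i : ℤ) - (j : ℤ)|) : Rel n (σ i * σ j) (σ j * σ i)
  | x_comm (i j : Fin (n - 1)) (h : 1 < |(i : ℤ) - (j : ℤ)|) : Rel n (χ i * χ j) (χ j * χ i)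
  | x_sigma_comm (i j : Fin (n - 1)) (h : |(i : ℤ) - (j : ℤ)| ≠ 1) :
      Rel n (χ i * σ j) (σ j * χ i)
  | braid (i j : Fin (n - 1)) (h : (j : ℕ) = (i : ℕ) + 1) :
      Rel n (σ i * σ j * σ i) (σ j * σ i * σ j)
  | slide_up (i j : Fin (n - 1)) (h : (j : ℕ) = (i : ℕ) + 1) :
      Rel n (σ i * σ j * χ i) (χ j * σ i * σ j)
  | slide_down (i j : Fin (n - 1)) (h : (j : ℕ) = (i : ℕ) + 1) :
      Rel n (σ j * σ i * χ j) (χ i * σ j * σ i)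

end SingularBraid

/-- The positive singular braid monoid `SB_n⁺`. -/
abbrev PosSingularBraidMonoid (n : ℕ) : Type := PresentedMonoid (SingularBraid.Rel n)

namespace SingularBraid

/-- The element of `SB_n⁺` represented by a positive word. -/
def eval {n : ℕ} (A : Word n) : PosSingularBraidMonoid n := PresentedMonoid.mk (Rel n) A

/-- `A ≐ B`: the words `A` and `B` are positively equal, i.e. equal as elements of `SB_n⁺`. -/
def PosEq {n : ℕ} (A B : Word n) : Prop := eval A = eval B

/-- The word `Π_t = σ_1 σ_2 ⋯ σ_t` (for `t ≤ n - 1`). -/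
def Pi (n t : ℕ) : Word n := (((List.finRange (n - 1)).take t).map σ).prod

/-- Garside's fundamental word `Δ = Π_{n-1} Π_{n-2} ⋯ Π_1`. -/
def Delta (n : ℕ) : Word n := ((List.range (n - 1)).reverse.map fun t => Pi n (t + 1)).prod

/-- A directed graph with edges labelled by `L`; the triple `(c, a, d)` is an edge with
label `a` that starts at `c` and ends at `d`. -/
structure LabelledDigraph (N L : Type*) where
  nodes : Set N
  edges : Set (N × L × N)
  start_mem : ∀ c a d, (c, a, d) ∈ edges → c ∈ nodes
  end_mem : ∀ c a d, (c, a, d) ∈ edges → d ∈ nodes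

/-- The node `c` is incident with an edge labelled `a`: such an edge starts or ends at `c`. -/
def LabelledDigraph.IncidentWith {N L : Type*} (D : LabelledDigraph N L) (c : N) (a : L) : Prop :=
  (∃ d, (c, a, d) ∈ D.edges) ∨ (∃ b, (b, a, c) ∈ D.edges)

/-- The Cayley diagram `D(W)` of a positive word `W`: the part of the Cayley graph of `SB_n⁺`
traversed by the paths that start at the identity and read the words positively equal to `W`.
Its nodes are the elements represented by initial segments of such words, and each occurrence
of a letter `a` in such a word `P a Q` gives the edge labelled `a` from `P` to `P a`. -/
def cayleyDiagram {n : ℕ} (W : Word n) :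
    LabelledDigraph (PosSingularBraidMonoid n) (SingularLetter n) where
  nodes := {c | ∃ P Q : Word n, PosEq (P * Q) W ∧ c = eval P}
  edges := {e | ∃ (P Q : Word n) (a : SingularLetter n),
    PosEq (P * FreeMonoid.of a * Q) W ∧ e = (eval P, a, eval (P * FreeMonoid.of a))}
  start_mem := by
    rintro c a d ⟨P, Q, b, h, he⟩
    simp only [Prod.mk.injEq] at he
    exact ⟨P, FreeMonoid.of b * Q, by rwa [← mul_assoc], he.1⟩
  end_mem := by
    rintro c a d ⟨P, Q, b, h, he⟩
    simp only [Prod.mk.injEq] at he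
    exact ⟨P * FreeMonoid.of b, Q, h, he.2.2⟩

end SingularBraid

/-! This is Garside's method. If `P Q ≐ W`, the node of `P` meets an edge labelled `σ_i` as soon as
`σ_i` is a right factor of `P` or a left factor of `Q`. Since `Δ` divides `P Q`, this follows from
`exists_eq_mul_s_or_s_dvd`, which is proved by induction on the length of the left factor. If that
factor is trivial, the claim is that `σ_i` divides `Δ` (`s_dvd_eval_Delta`); otherwise its last
letter is compared with `σ_i`.

The comparison rests on `lcmBelow`, which describes all equations `a A = b B` with letters `a`, `b`.
Two distinct letters begin the two sides of at most one defining relation. That relation gives their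
least common right multiple; without one, as for adjacent `x_i`, `x_j`, there is no common multiple;
and equal letters cancel. Relations preserve length, so induction on length applies: a chain of
relations from `a A` to `b B` is composed link by link by `IsLcm.trans`, which uses the claim only
for shorter elements. Its content is the cube condition, checked on triples of letters. -/

namespace SingularBraid

variable {n : ℕ}

/-! ### Generators, index positions and the relations in the monoid. -/

/-- The generator of `SB_n⁺` given by a letter. -/
def gen (a : SingularLetter n) : PosSingularBraidMonoid n := eval (FreeMonoid.of a)

/-- The generator `σ_i` of `SB_n⁺`. -/
abbrev s (i : Fin (n - 1)) : PosSingularBraidMonoid n := gen (SingularLetter.sigma i)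

/-- The generator `x_i` of `SB_n⁺`. -/
abbrev x (i : Fin (n - 1)) : PosSingularBraidMonoid n := gen (SingularLetter.x i)

theorem eval_mul (A B : Word n) : eval (A * B) = eval A * eval B := rfl

theorem eval_σ (i : Fin (n - 1)) : eval (σ i) = s i := rfl

theorem eval_χ (i : Fin (n - 1)) : eval (χ i) = x i := rfl

/-- Two indices differ by one. -/
def Adj (i j : Fin (n - 1)) : Prop := (j : ℕ) = (i : ℕ) + 1 ∨ (i : ℕ) = (j : ℕ) + 1

/-- Two indices differ by more than one. -/
def Far (i j : Fin (n - 1)) : Prop := (i : ℕ) + 1 < (j : ℕ) ∨ (j : ℕ) + 1 < (i : ℕ)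

theorem Adj.symm {i j : Fin (n - 1)} (h : Adj i j) : Adj j i := Or.symm h

theorem Far.symm {i j : Fin (n - 1)} (h : Far i j) : Far j i := Or.symm h

theorem Far.not_adj {i j : Fin (n - 1)} (h : Far i j) : ¬ Adj i j := by
  unfold Adj; unfold Far at h; omega

theorem not_adj_self (i : Fin (n - 1)) : ¬ Adj i i := by
  unfold Adj; omega

theorem eq_or_adj_or_far (i j : Fin (n - 1)) : i = j ∨ Adj i j ∨ Far i j := by
  unfold Adj Far; rw [Fin.ext_iff]; omega

theorem far_of_not_adj {i j : Fin (n - 1)} (h : ¬ Adj i j) (hne : i ≠ j) : Far i j := by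
  rcases eq_or_adj_or_far i j with h' | h' | h'
  exacts [absurd h' hne, absurd h' h, h']

/-- The path graph contains no triangle. -/
theorem far_of_adj_adj {i j k : Fin (n - 1)} (h : Adj i j) (h' : Adj j k) (hne : i ≠ k) :
    Far i k := by
  unfold Adj at h h'; unfold Far; rw [Ne, Fin.ext_iff] at hne; omega

theorem one_lt_abs_of_far {i j : Fin (n - 1)} (h : Far i j) : 1 < |(i : ℤ) - (j : ℤ)| := by
  unfold Far at h; rw [lt_abs]; omega

theorem abs_ne_one_of_not_adj {i j : Fin (n - 1)} (h : ¬ Adj i j) : |(i : ℤ) - (j : ℤ)| ≠ 1 := by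
  unfold Adj at h; rw [Ne, abs_eq zero_le_one]; omega

theorem eval_eq_of_rel {A B : Word n} (h : Rel n A B) : eval A = eval B :=
  (Con.eq _).2 (ConGen.Rel.of _ _ h)

/-- The free right factor lets each relation rewrite inside right-nested products. -/
theorem s_mul_s_of_far {i j : Fin (n - 1)} (h : Far i j) (A : PosSingularBraidMonoid n) :
    s i * (s j * A) = s j * (s i * A) := by
  simpa only [eval_mul, eval_σ, eval_χ, mul_assoc] using
    congrArg (· * A) (eval_eq_of_rel (Rel.sigma_comm i j (one_lt_abs_of_far h)))

theorem x_mul_x_of_far {i j : Fin (n - 1)} (h : Far i j) (A : PosSingularBraidMonoid n) :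
    x i * (x j * A) = x j * (x i * A) := by
  simpa only [eval_mul, eval_σ, eval_χ, mul_assoc] using
    congrArg (· * A) (eval_eq_of_rel (Rel.x_comm i j (one_lt_abs_of_far h)))

theorem x_mul_s_of_not_adj {i j : Fin (n - 1)} (h : ¬ Adj i j) (A : PosSingularBraidMonoid n) :
    x i * (s j * A) = s j * (x i * A) := by
  simpa only [eval_mul, eval_σ, eval_χ, mul_assoc] using
    congrArg (· * A) (eval_eq_of_rel (Rel.x_sigma_comm i j (abs_ne_one_of_not_adj h)))

theorem braid_mul {i j : Fin (n - 1)} (h : Adj i j) (A : PosSingularBraidMonoid n) :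
    s i * (s j * (s i * A)) = s j * (s i * (s j * A)) := by
  rcases h with h | h
  · simpa only [eval_mul, eval_σ, eval_χ, mul_assoc] using congrArg (· * A) (eval_eq_of_rel
        (Rel.braid i j h))
  · simpa only [eval_mul, eval_σ, eval_χ, mul_assoc] using congrArg (· * A) (eval_eq_of_rel
        (Rel.braid j i h)).symm

theorem slide_mul {i j : Fin (n - 1)} (h : Adj i j) (A : PosSingularBraidMonoid n) :
    s i * (s j * (x i * A)) = x j * (s i * (s j * A)) := by
  rcases h with h | h
  · simpa only [eval_mul, eval_σ, eval_χ, mul_assoc] using congrArg (· * A) (eval_eq_of_rel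
        (Rel.slide_up i j h))
  · simpa only [eval_mul, eval_σ, eval_χ, mul_assoc] using congrArg (· * A) (eval_eq_of_rel
        (Rel.slide_down j i h))

/-! ### Least common multiples of letters, and length. -/

/-- The two letters are different and a defining relation makes them commute. -/
inductive Commuting : SingularLetter n → SingularLetter n → Prop
  | ss {i j : Fin (n - 1)} (h : Far i j) : Commuting (.sigma i) (.sigma j)
  | xx {i j : Fin (n - 1)} (h : Far i j) : Commuting (.x i) (.x j)
  | sx {i j : Fin (n - 1)} (h : ¬ Adj i j) : Commuting (.sigma i) (.x j)
  | xs {i j : Fin (n - 1)} (h : ¬ Adj i j) : Commuting (.x i) (.sigma j)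

theorem Commuting.symm {a b : SingularLetter n} (h : Commuting a b) : Commuting b a := by
  cases h with
  | ss h => exact .ss h.symm
  | xx h => exact .xx h.symm
  | sx h => exact .xs fun h' => h h'.symm
  | xs h => exact .sx fun h' => h h'.symm

theorem Commuting.mul {a b : SingularLetter n} (h : Commuting a b)
    (A : PosSingularBraidMonoid n) : gen a * (gen b * A) = gen b * (gen a * A) := by
  cases h with
  | ss h => exact s_mul_s_of_far h A
  | xx h => exact x_mul_x_of_far h A
  | sx h => exact (x_mul_s_of_not_adj (fun h' => h h'.symm) A).symm
  | xs h => exact x_mul_s_of_not_adj h A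

/-- The index of a letter. -/
def idx : SingularLetter n → Fin (n - 1)
  | .sigma i => i
  | .x i => i

theorem Commuting.of_far {a b : SingularLetter n} (h : Far (idx a) (idx b)) : Commuting a b := by
  cases a <;> cases b
  exacts [.ss h, .sx h.not_adj, .xs h.not_adj, .xx h]

theorem Commuting.not_adj {a b : SingularLetter n} (h : Commuting a b) : ¬ Adj (idx a) (idx b) := by
  cases h with
  | ss h => exact h.not_adj
  | xx h => exact h.not_adj
  | sx h => exact h
  | xs h => exact h

/-- `IsLcm a b A B` says that `a A = b B` holds because both sides are the same right multiple of
the least common multiple of the letters `a` and `b` given by the defining relations. -/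
inductive IsLcm : SingularLetter n → SingularLetter n →
    PosSingularBraidMonoid n → PosSingularBraidMonoid n → Prop
  | refl (a : SingularLetter n) {A B : PosSingularBraidMonoid n} (h : A = B) : IsLcm a a A B
  | comm {a b : SingularLetter n} (h : Commuting a b) {A B : PosSingularBraidMonoid n}
      (C : PosSingularBraidMonoid n) (hA : A = gen b * C) (hB : B = gen a * C) : IsLcm a b A B
  | ss {i j : Fin (n - 1)} (h : Adj i j) {A B : PosSingularBraidMonoid n}
      (C : PosSingularBraidMonoid n) (hA : A = s j * (s i * C)) (hB : B = s i * (s j * C)) :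
      IsLcm (.sigma i) (.sigma j) A B
  | sx {i j : Fin (n - 1)} (h : Adj i j) {A B : PosSingularBraidMonoid n}
      (C : PosSingularBraidMonoid n) (hA : A = s j * (x i * C)) (hB : B = s i * (s j * C)) :
      IsLcm (.sigma i) (.x j) A B
  | xs {i j : Fin (n - 1)} (h : Adj i j) {A B : PosSingularBraidMonoid n}
      (C : PosSingularBraidMonoid n) (hA : A = s j * (s i * C)) (hB : B = s i * (x j * C)) :
      IsLcm (.x i) (.sigma j) A B

theorem IsLcm.symm {a b : SingularLetter n} {A B : PosSingularBraidMonoid n}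
    (h : IsLcm a b A B) : IsLcm b a B A := by
  cases h with
  | refl a h => exact .refl a h.symm
  | comm h C hA hB => exact .comm h.symm C hB hA
  | ss h C hA hB => exact .ss h.symm C hB hA
  | sx h C hA hB => exact .xs h.symm C hB hA
  | xs h C hA hB => exact .sx h.symm C hB hA

theorem IsLcm.mul_right {a b : SingularLetter n} {A B : PosSingularBraidMonoid n}
    (h : IsLcm a b A B) (D : PosSingularBraidMonoid n) : IsLcm a b (A * D) (B * D) := by
  cases h with
  | refl a h => exact .refl a (by rw [h])
  | comm h C hA hB =>
      exact .comm h (C * D) (by simp only [hA, mul_assoc]) (by simp only [hB, mul_assoc])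
  | ss h C hA hB =>
      exact .ss h (C * D) (by simp only [hA, mul_assoc]) (by simp only [hB, mul_assoc])
  | sx h C hA hB =>
      exact .sx h (C * D) (by simp only [hA, mul_assoc]) (by simp only [hB, mul_assoc])
  | xs h C hA hB =>
      exact .xs h (C * D) (by simp only [hA, mul_assoc]) (by simp only [hB, mul_assoc])

/-- The common length of the words representing an element of `SB_n⁺`. -/
def lenHom (n : ℕ) : PosSingularBraidMonoid n →* Multiplicative ℕ :=
  PresentedMonoid.lift (fun _ => Multiplicative.ofAdd 1) (by
    intro A B h
    cases h <;> simp [σ, χ])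

/-- The length of an element of `SB_n⁺`. -/
def len (A : PosSingularBraidMonoid n) : ℕ := Multiplicative.toAdd (lenHom n A)

theorem len_mul (A B : PosSingularBraidMonoid n) : len (A * B) = len A + len B := by
  simp [len]

theorem len_gen (a : SingularLetter n) : len (gen a) = 1 := rfl

theorem len_gen_mul (a : SingularLetter n) (A : PosSingularBraidMonoid n) :
    len (gen a * A) = len A + 1 := by
  rw [len_mul, len_gen, add_comm]

/-- Common right multiples of two letters, with cofactors shorter than `N`, are multiples of the
least common multiple given by the defining relations. -/
def LcmBelow (n N : ℕ) : Prop :=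
  ∀ (a b : SingularLetter n) (A B : PosSingularBraidMonoid n),
    len A < N → gen a * A = gen b * B → IsLcm a b A B

namespace LcmBelow

variable {N : ℕ} {i j : Fin (n - 1)} {A B : PosSingularBraidMonoid n}

/-- Only `refl` can relate a letter to itself: no letter is `Commuting` with itself or adjacent to
itself. -/
theorem cancel (H : LcmBelow n N) {a : SingularLetter n} (hN : len A < N)
    (h : gen a * A = gen a * B) : A = B := by
  cases H _ _ _ _ hN h with
  | refl _ h => exact h
  | comm h => cases h with
    | ss h => unfold Far at h; omega
    | xx h => unfold Far at h; omega
  | ss h => exact absurd h (not_adj_self _)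

theorem comm (H : LcmBelow n N) {a b : SingularLetter n} (hab : Commuting a b) (hN : len A < N)
    (hAB : gen a * A = gen b * B) : ∃ C, A = gen b * C ∧ B = gen a * C := by
  cases H _ _ _ _ hN hAB with
  | refl => cases hab with
    | ss h => unfold Far at h; omega
    | xx h => unfold Far at h; omega
  | comm _ C hA hB => exact ⟨C, hA, hB⟩
  | ss h => exact absurd h hab.not_adj
  | sx h => exact absurd h hab.not_adj
  | xs h => exact absurd h hab.not_adj

theorem ss (H : LcmBelow n N) (hij : Adj i j) (hN : len A < N) (h : s i * A = s j * B) :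
    ∃ C, A = s j * (s i * C) ∧ B = s i * (s j * C) := by
  cases H _ _ _ _ hN h with
  | refl => exact absurd hij (not_adj_self _)
  | comm h => exact absurd hij h.not_adj
  | ss _ C hA hB => exact ⟨C, hA, hB⟩

theorem sx (H : LcmBelow n N) (hij : Adj i j) (hN : len A < N) (h : s i * A = x j * B) :
    ∃ C, A = s j * (x i * C) ∧ B = s i * (s j * C) := by
  cases H _ _ _ _ hN h with
  | comm h => exact absurd hij h.not_adj
  | sx _ C hA hB => exact ⟨C, hA, hB⟩

theorem xs (H : LcmBelow n N) (hij : Adj i j) (hN : len A < N) (h : x i * A = s j * B) :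
    ∃ C, A = s j * (s i * C) ∧ B = s i * (x j * C) := by
  cases H _ _ _ _ hN h with
  | comm h => exact absurd hij h.not_adj
  | xs _ C hA hB => exact ⟨C, hA, hB⟩

/-- No defining relation has sides beginning with adjacent `x_i` and `x_j`, so `IsLcm` has no
constructor for them. -/
theorem xx (H : LcmBelow n N) (hij : Adj i j) (hN : len A < N) (h : x i * A = x j * B) : False := by
  cases H _ _ _ _ hN h with
  | refl => exact absurd hij (not_adj_self _)
  | comm h => exact absurd hij h.not_adj

end LcmBelow

/-! ### The cube condition for triples of letters. -/

section Cube

variable {N : ℕ} {i j k : Fin (n - 1)} {C E : PosSingularBraidMonoid n}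

/-- In these names `mid` means that `i` lies between `j` and `k`, `far` that `j` lies between `i`
and `k`, and `same` that the second and third letters share the index `j`; the suffix lists the
kinds of the three letters. Each proof resolves the middle cofactor by multiples of shorter elements
until a free factor is left. -/
theorem cube_mid_sss (H : LcmBelow n N) (hij : Adj i j) (hik : Adj i k) (hjk : Far j k)
    (hN : len (s i * (s j * C)) ≤ N) (h : s i * (s j * C) = s k * E) :
    IsLcm (.sigma i) (.sigma k) (s j * (s i * C)) (s j * E) := by
  obtain ⟨F, h1, rfl⟩ := H.ss hik (by simp only [len_gen_mul] at hN ⊢; omega) h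
  obtain ⟨G, rfl, h2⟩ := H.comm (.ss hjk) (by simp only [len_gen_mul] at hN ⊢; omega) h1
  obtain ⟨K, rfl, rfl⟩ := H.ss hij.symm (by simp only [len_gen_mul] at hN ⊢; omega) h2.symm
  have e1 := @s_mul_s_of_far _ _ _ hjk
  have e5 := @braid_mul _ _ _ hij
  have e6 := @braid_mul _ _ _ hik
  -- The witness completes `σ_i σ_k σ_i` to a common multiple of all three letters.
  exact .ss hik (s j * (s i * (s k * K))) (by grind) (by grind)

theorem cube_mid_ssx (H : LcmBelow n N) (hij : Adj i j) (hik : Adj i k) (hjk : Far j k)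
    (hN : len (s i * (s j * C)) ≤ N) (h : s i * (s j * C) = x k * E) :
    IsLcm (.sigma i) (.x k) (s j * (s i * C)) (s j * E) := by
  obtain ⟨F, h1, rfl⟩ := H.sx hik (by simp only [len_gen_mul] at hN ⊢; omega) h
  obtain ⟨G, rfl, h2⟩ := H.comm (.ss hjk) (by simp only [len_gen_mul] at hN ⊢; omega) h1
  obtain ⟨K, rfl, rfl⟩ := H.sx hij.symm (by simp only [len_gen_mul] at hN ⊢; omega) h2.symm
  have hji := hij.symm
  have e1 := @s_mul_s_of_far _ _ _ hjk
  have e2 := @x_mul_s_of_not_adj _ _ _ hjk.not_adj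
  have e5 := @braid_mul _ _ _ hij
  have e6 := @braid_mul _ _ _ hik
  have e9 := @slide_mul _ _ _ hji
  exact .sx hik (s j * (s i * (s k * K))) (by grind) (by grind)

theorem cube_mid_sxs (H : LcmBelow n N) (hij : Adj i j) (hik : Adj i k) (hjk : Far j k)
    (hN : len (s i * (s j * C)) ≤ N) (h : s i * (s j * C) = s k * E) :
    IsLcm (.sigma i) (.sigma k) (s j * (x i * C)) (x j * E) := by
  obtain ⟨F, h1, rfl⟩ := H.ss hik (by simp only [len_gen_mul] at hN ⊢; omega) h
  obtain ⟨G, rfl, h2⟩ := H.comm (.ss hjk) (by simp only [len_gen_mul] at hN ⊢; omega) h1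
  obtain ⟨K, rfl, rfl⟩ := H.ss hij.symm (by simp only [len_gen_mul] at hN ⊢; omega) h2.symm
  have hkj := hjk.symm
  have hki := hik.symm
  have e1 := @s_mul_s_of_far _ _ _ hjk
  have e3 := @x_mul_s_of_not_adj _ _ _ hkj.not_adj
  have e5 := @braid_mul _ _ _ hij
  have e7 := @slide_mul _ _ _ hij
  have e10 := @slide_mul _ _ _ hki
  exact .ss hik (s j * (s i * (x k * K))) (by grind) (by grind)

theorem cube_mid_sxx (H : LcmBelow n N) (hij : Adj i j) (hik : Adj i k) (hjk : Far j k)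
    (hN : len (s i * (s j * C)) ≤ N) (h : s i * (s j * C) = x k * E) :
    IsLcm (.sigma i) (.x k) (s j * (x i * C)) (x j * E) := by
  obtain ⟨F, h1, rfl⟩ := H.sx hik (by simp only [len_gen_mul] at hN ⊢; omega) h
  obtain ⟨G, rfl, h2⟩ := H.comm (.ss hjk) (by simp only [len_gen_mul] at hN ⊢; omega) h1
  obtain ⟨K, rfl, rfl⟩ := H.sx hij.symm (by simp only [len_gen_mul] at hN ⊢; omega) h2.symm
  have hki := hik.symm
  have hji := hij.symm
  have e1 := @s_mul_s_of_far _ _ _ hjk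
  have e4 := @x_mul_x_of_far _ _ _ hjk
  have e7 := @slide_mul _ _ _ hij
  have e9 := @slide_mul _ _ _ hji
  have e10 := @slide_mul _ _ _ hki
  exact .sx hik (s j * (s i * (x k * K))) (by grind) (by grind)

theorem cube_mid_xss (H : LcmBelow n N) (hij : Adj i j) (hik : Adj i k) (hjk : Far j k)
    (hN : len (s i * (x j * C)) ≤ N) (h : s i * (x j * C) = s k * E) :
    IsLcm (.x i) (.sigma k) (s j * (s i * C)) (s j * E) := by
  obtain ⟨F, h1, rfl⟩ := H.ss hik (by simp only [len_gen_mul] at hN ⊢; omega) h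
  obtain ⟨G, rfl, h2⟩ := H.comm (.xs hjk.not_adj) (by simp only [len_gen_mul] at hN ⊢; omega) h1
  obtain ⟨K, rfl, rfl⟩ := H.xs hij.symm (by simp only [len_gen_mul] at hN ⊢; omega) h2.symm
  have hkj := hjk.symm
  have e1 := @s_mul_s_of_far _ _ _ hjk
  have e3 := @x_mul_s_of_not_adj _ _ _ hkj.not_adj
  have e5 := @braid_mul _ _ _ hij
  have e6 := @braid_mul _ _ _ hik
  have e8 := @slide_mul _ _ _ hik
  exact .xs hik (s j * (s i * (s k * K))) (by grind) (by grind)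

theorem cube_far_sss (H : LcmBelow n N) (hij : Adj i j) (hjk : Adj j k) (hik : Far i k)
    (hN : len (s i * (s j * C)) ≤ N) (hN' : len (s k * (s j * E)) ≤ N)
    (h : s i * (s j * C) = s k * (s j * E)) :
    IsLcm (.sigma i) (.sigma k) (s j * (s i * C)) (s j * (s k * E)) := by
  obtain ⟨F, h1, h2⟩ := H.comm (.ss hik) (by simp only [len_gen_mul] at hN ⊢; omega) h
  obtain ⟨G, rfl, rfl⟩ := H.ss hjk (by simp only [len_gen_mul] at hN ⊢; omega) h1
  obtain ⟨G', rfl, h3⟩ := H.ss hij.symm (by simp only [len_gen_mul] at hN' ⊢; omega) h2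
  replace h3 := H.cancel (by simp only [len_gen_mul] at hN ⊢; omega) h3
  obtain ⟨K, rfl, rfl⟩ := H.comm (.ss hik.symm) (by simp only [len_gen_mul] at hN ⊢; omega) h3
  have hkj := hjk.symm
  have e1 := @s_mul_s_of_far _ _ _ hik
  have e5 := @braid_mul _ _ _ hij
  have e6 := @braid_mul _ _ _ hkj
  exact .comm (.ss hik) (s j * (s k * (s i * (s j * K)))) (by grind) (by grind)

theorem cube_far_xss (H : LcmBelow n N) (hij : Adj i j) (hjk : Adj j k) (hik : Far i k)
    (hN : len (s i * (x j * C)) ≤ N) (hN' : len (s k * (s j * E)) ≤ N)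
    (h : s i * (x j * C) = s k * (s j * E)) :
    IsLcm (.x i) (.sigma k) (s j * (s i * C)) (s j * (s k * E)) := by
  obtain ⟨F, h1, h2⟩ := H.comm (.ss hik) (by simp only [len_gen_mul] at hN ⊢; omega) h
  obtain ⟨G, rfl, rfl⟩ := H.xs hjk (by simp only [len_gen_mul] at hN ⊢; omega) h1
  obtain ⟨G', rfl, h3⟩ := H.ss hij.symm (by simp only [len_gen_mul] at hN' ⊢; omega) h2
  replace h3 := H.cancel (by simp only [len_gen_mul] at hN ⊢; omega) h3
  obtain ⟨K, rfl, rfl⟩ :=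
      H.comm (.xs hik.symm.not_adj) (by simp only [len_gen_mul] at hN ⊢; omega) h3
  have hji := hij.symm
  have hkj := hjk.symm
  have e1 := @s_mul_s_of_far _ _ _ hik
  have e5 := @braid_mul _ _ _ hij
  have e6 := @braid_mul _ _ _ hkj
  have e8 := @slide_mul _ _ _ hkj
  have e9 := @slide_mul _ _ _ hji
  exact .comm (.xs hik.not_adj) (s j * (s k * (s i * (s j * K)))) (by grind) (by grind)

theorem cube_far_xsx (H : LcmBelow n N) (hij : Adj i j) (hjk : Adj j k) (hik : Far i k)
    (hN : len (s i * (x j * C)) ≤ N) (hN' : len (s k * (x j * E)) ≤ N)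
    (h : s i * (x j * C) = s k * (x j * E)) :
    IsLcm (.x i) (.x k) (s j * (s i * C)) (s j * (s k * E)) := by
  obtain ⟨F, h1, h2⟩ := H.comm (.ss hik) (by simp only [len_gen_mul] at hN ⊢; omega) h
  obtain ⟨G, rfl, rfl⟩ := H.xs hjk (by simp only [len_gen_mul] at hN ⊢; omega) h1
  obtain ⟨G', rfl, h3⟩ := H.xs hij.symm (by simp only [len_gen_mul] at hN' ⊢; omega) h2
  replace h3 := H.cancel (by simp only [len_gen_mul] at hN ⊢; omega) h3
  obtain ⟨K, rfl, rfl⟩ := H.comm (.xx hik.symm) (by simp only [len_gen_mul] at hN ⊢; omega) h3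
  have hji := hij.symm
  have hkj := hjk.symm
  have e1 := @s_mul_s_of_far _ _ _ hik
  have e7 := @slide_mul _ _ _ hij
  have e8 := @slide_mul _ _ _ hkj
  have e9 := @slide_mul _ _ _ hji
  have e10 := @slide_mul _ _ _ hjk
  exact .comm (.xx hik) (s j * (s k * (s i * (s j * K)))) (by grind) (by grind)

theorem cube_far_sxs (H : LcmBelow n N) (hij : Adj i j) (hjk : Adj j k) (hik : Far i k)
    (hN : len (s i * (s j * C)) ≤ N) (hN' : len (s k * (s j * E)) ≤ N)
    (h : s i * (s j * C) = s k * (s j * E)) :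
    IsLcm (.sigma i) (.sigma k) (s j * (x i * C)) (s j * (x k * E)) := by
  obtain ⟨F, h1, h2⟩ := H.comm (.ss hik) (by simp only [len_gen_mul] at hN ⊢; omega) h
  obtain ⟨G, rfl, rfl⟩ := H.ss hjk (by simp only [len_gen_mul] at hN ⊢; omega) h1
  obtain ⟨G', rfl, h3⟩ := H.ss hij.symm (by simp only [len_gen_mul] at hN' ⊢; omega) h2
  replace h3 := H.cancel (by simp only [len_gen_mul] at hN ⊢; omega) h3
  obtain ⟨K, rfl, rfl⟩ := H.comm (.ss hik.symm) (by simp only [len_gen_mul] at hN ⊢; omega) h3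
  have hki := hik.symm
  have hji := hij.symm
  have hkj := hjk.symm
  have e1 := @s_mul_s_of_far _ _ _ hik
  have e2 := @x_mul_s_of_not_adj _ _ _ hik.not_adj
  have e3 := @x_mul_s_of_not_adj _ _ _ hki.not_adj
  have e5 := @braid_mul _ _ _ hij
  have e6 := @braid_mul _ _ _ hkj
  have e9 := @slide_mul _ _ _ hji
  have e10 := @slide_mul _ _ _ hjk
  exact .comm (.ss hik) (s j * (s k * (s i * (x j * K)))) (by grind) (by grind)

theorem cube_same_ssx (H : LcmBelow n N) (hij : Adj i j)
    (hN : len (s i * (s j * C)) ≤ N) (h : s i * (s j * C) = x j * E) :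
    IsLcm (.sigma i) (.x j) (s j * (s i * C)) (s j * E) := by
  obtain ⟨F, h1, rfl⟩ := H.sx hij (by simp only [len_gen_mul] at hN ⊢; omega) h
  obtain rfl := H.cancel (by simp only [len_gen_mul] at hN ⊢; omega) h1
  have e1 := @braid_mul _ _ _ hij
  have e2 := @x_mul_s_of_not_adj _ _ _ (not_adj_self i)
  exact .sx hij (s i * F) (by grind) (by grind)

theorem cube_same_sxs (H : LcmBelow n N) (hij : Adj i j)
    (hN : len (s i * (s j * C)) ≤ N) (h : s i * (s j * C) = s j * E) :
    IsLcm (.sigma i) (.sigma j) (s j * (x i * C)) (x j * E) := by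
  obtain ⟨F, h1, rfl⟩ := H.ss hij (by simp only [len_gen_mul] at hN ⊢; omega) h
  obtain rfl := H.cancel (by simp only [len_gen_mul] at hN ⊢; omega) h1
  have e1 := @slide_mul _ _ _ hij
  have e2 := @x_mul_s_of_not_adj _ _ _ (not_adj_self i)
  exact .ss hij (x i * F) (by grind) (by grind)

/-- The equation would give the adjacent letters `x_i` and `x_j` a common multiple. -/
theorem cube_same_xsx (H : LcmBelow n N) (hij : Adj i j)
    (hN : len (s i * (x j * C)) ≤ N) (h : s i * (x j * C) = x j * E) : False := by
  obtain ⟨F, h1, rfl⟩ := H.sx hij (by simp only [len_gen_mul] at hN ⊢; omega) h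
  obtain ⟨G, rfl, h2⟩ :=
      H.comm (.xs (not_adj_self j)) (by simp only [len_gen_mul] at hN ⊢; omega) h1
  exact H.xx hij.symm (by simp only [len_gen_mul] at hN ⊢; omega) h2.symm

theorem cube_mid_xsx (H : LcmBelow n N) (hij : Adj i j) (hik : Adj i k) (hjk : Far j k)
    (hN : len (s i * (x j * C)) ≤ N) (h : s i * (x j * C) = x k * E) : False := by
  obtain ⟨F, h1, rfl⟩ := H.sx hik (by simp only [len_gen_mul] at hN ⊢; omega) h
  obtain ⟨G, rfl, h2⟩ := H.comm (.xs hjk.not_adj) (by simp only [len_gen_mul] at hN ⊢; omega) h1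
  exact H.xx hij.symm (by simp only [len_gen_mul] at hN ⊢; omega) h2.symm

/-- Here the third letter returns to the index of the first: `σ_i` and `x_i` commute although both
are adjacent to the middle letter `σ_j`. -/
theorem cube_pair (H : LcmBelow n N) (hij : Adj i j)
    (hN : len (s i * (s j * C)) ≤ N) (h : s i * (s j * C) = s i * (x j * E)) :
    IsLcm (.sigma i) (.x i) (s j * (s i * C)) (s j * (s i * E)) := by
  obtain ⟨F, rfl, rfl⟩ :=
      H.comm (.sx (not_adj_self j)) (by simp only [len_gen_mul] at hN ⊢; omega)
        (H.cancel (by simp only [len_gen_mul] at hN ⊢; omega) h)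
  have e1 := @slide_mul _ _ _ hij.symm
  have e2 := @braid_mul _ _ _ hij
  exact .comm (.sx (not_adj_self i)) (s j * (s i * F)) (by grind) (by grind)

end Cube

/-! ### Transitivity of `IsLcm`. -/

/-- If `b` had the index of `a` or of `c`, it would be adjacent to the other. -/
theorem Commuting.far_of_adj {a b c : SingularLetter n} (hab : Commuting a b)
    (hbc : Commuting b c) (h : Adj (idx a) (idx c)) :
    Far (idx b) (idx a) ∧ Far (idx b) (idx c) := by
  have h1 := hab.not_adj
  have h2 := hbc.not_adj
  unfold Adj at h h1 h2
  unfold Far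
  omega

theorem cube_comm {N : ℕ} {a b c : SingularLetter n} {C E : PosSingularBraidMonoid n}
    (H : LcmBelow n N) (hab : Commuting a b) (hbc : Commuting b c)
    (hN : len (gen a * C) ≤ N) (h : gen a * C = gen c * E) :
    IsLcm a c (gen b * C) (gen b * E) := by
  cases H _ _ _ _ (by simp only [len_gen_mul] at hN ⊢; omega) h with
  | refl _ h => exact .refl _ (by rw [h])
  | comm h' F hA hB =>
    exact .comm h' (gen b * F) (by rw [hA, hbc.mul]) (by rw [hB, hab.mul])
  | @ss i j hij _ _ F hA hB =>
    obtain ⟨ha, hc⟩ := hab.far_of_adj hbc hij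
    rw [hA, hB]
    refine .ss hij (gen b * F) ?_ ?_
    · rw [(Commuting.of_far (a := b) (b := .sigma j) hc).mul,
          (Commuting.of_far (a := b) (b := .sigma i) ha).mul]
    · rw [(Commuting.of_far (a := b) (b := .sigma i) ha).mul,
          (Commuting.of_far (a := b) (b := .sigma j) hc).mul]
  | @sx i j hij _ _ F hA hB =>
    obtain ⟨ha, hc⟩ := hab.far_of_adj hbc hij
    rw [hA, hB]
    refine .sx hij (gen b * F) ?_ ?_
    · rw [(Commuting.of_far (a := b) (b := .sigma j) hc).mul,
          (Commuting.of_far (a := b) (b := .x i) ha).mul]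
    · rw [(Commuting.of_far (a := b) (b := .sigma i) ha).mul,
          (Commuting.of_far (a := b) (b := .sigma j) hc).mul]
  | @xs i j hij _ _ F hA hB =>
    obtain ⟨ha, hc⟩ := hab.far_of_adj hbc hij
    rw [hA, hB]
    refine .xs hij (gen b * F) ?_ ?_
    · rw [(Commuting.of_far (a := b) (b := .sigma j) hc).mul,
          (Commuting.of_far (a := b) (b := .sigma i) ha).mul]
    · rw [(Commuting.of_far (a := b) (b := .sigma i) ha).mul,
          (Commuting.of_far (a := b) (b := .x j) hc).mul]

/-- If `c` is far from both indices of the first link, it passes through every letter there.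
Otherwise, as `c` commutes with `b`, its index is that of `b` or a neighbour of that of `a`, and a
cube lemma applies. -/
theorem IsLcm.trans_comm {N : ℕ} (H : LcmBelow n N) {a b c : SingularLetter n}
    {A B E : PosSingularBraidMonoid n} (hab : IsLcm a b A B) (hbc : Commuting b c)
    (hN : len B ≤ N) (hB : B = gen c * E) : IsLcm a c A (gen b * E) := by
  cases hab with
  | refl _ h => exact .comm hbc E (h.trans hB) rfl
  | comm hab C hA hB' =>
    subst hA hB'
    exact cube_comm H hab hbc hN hB
  | @ss i j hij _ _ C hA hB' =>
    subst hA hB'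
    by_cases hac : Far i (idx c) ∧ Far j (idx c)
    · have hsi := Commuting.of_far (a := .sigma i) hac.1
      have hsj := Commuting.of_far (a := .sigma j) hac.2
      have h_i := Commuting.of_far (a := .x i) hac.1
      have h_j := Commuting.of_far (a := .x j) hac.2
      obtain ⟨F, h1, rfl⟩ := H.comm hsi (by simp only [len_gen_mul] at hN ⊢; omega) hB
      obtain ⟨G, rfl, rfl⟩ := H.comm hsj (by simp only [len_gen_mul] at hN ⊢; omega) h1
      refine .comm hsi (s j * (s i * G)) ?_ ?_
      · rw [hsi.mul, hsj.mul]
      · exact braid_mul hij.symm _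
    cases hbc with
    | ss hjk =>
      rename_i k
      rcases eq_or_adj_or_far i k with rfl | hik | hik
      · exact absurd hij hjk.symm.not_adj
      · exact cube_mid_sss H hij hik hjk hN hB
      · exact absurd ⟨hik, hjk⟩ hac
    | sx hjk =>
      rename_i k
      rcases eq_or_ne j k with rfl | hne
      · exact cube_same_ssx H hij hN hB
      replace hjk := far_of_not_adj hjk hne
      rcases eq_or_adj_or_far i k with rfl | hik | hik
      · exact absurd hij hjk.symm.not_adj
      · exact cube_mid_ssx H hij hik hjk hN hB
      · exact absurd ⟨hik, hjk⟩ hac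
  | @sx i j hij _ _ C hA hB' =>
    subst hA hB'
    by_cases hac : Far i (idx c) ∧ Far j (idx c)
    · have hsi := Commuting.of_far (a := .sigma i) hac.1
      have hsj := Commuting.of_far (a := .sigma j) hac.2
      have h_i := Commuting.of_far (a := .x i) hac.1
      have h_j := Commuting.of_far (a := .x j) hac.2
      obtain ⟨F, h1, rfl⟩ := H.comm hsi (by simp only [len_gen_mul] at hN ⊢; omega) hB
      obtain ⟨G, rfl, rfl⟩ := H.comm hsj (by simp only [len_gen_mul] at hN ⊢; omega) h1
      refine .comm hsi (s j * (x i * G)) ?_ ?_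
      · rw [h_i.mul, hsj.mul]
      · exact (slide_mul hij _).symm
    cases hbc with
    | xs hjk =>
      rename_i k
      rcases eq_or_ne j k with rfl | hne
      · exact cube_same_sxs H hij hN hB
      replace hjk := far_of_not_adj hjk hne
      rcases eq_or_adj_or_far i k with rfl | hik | hik
      · exact absurd hij hjk.symm.not_adj
      · exact cube_mid_sxs H hij hik hjk hN hB
      · exact absurd ⟨hik, hjk⟩ hac
    | xx hjk =>
      rename_i k
      rcases eq_or_adj_or_far i k with rfl | hik | hik
      · exact absurd hij hjk.symm.not_adj
      · exact cube_mid_sxx H hij hik hjk hN hB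
      · exact absurd ⟨hik, hjk⟩ hac
  | @xs i j hij _ _ C hA hB' =>
    subst hA hB'
    by_cases hac : Far i (idx c) ∧ Far j (idx c)
    · have hsi := Commuting.of_far (a := .sigma i) hac.1
      have hsj := Commuting.of_far (a := .sigma j) hac.2
      have h_i := Commuting.of_far (a := .x i) hac.1
      have h_j := Commuting.of_far (a := .x j) hac.2
      obtain ⟨F, h1, rfl⟩ := H.comm hsi (by simp only [len_gen_mul] at hN ⊢; omega) hB
      obtain ⟨G, rfl, rfl⟩ := H.comm h_j (by simp only [len_gen_mul] at hN ⊢; omega) h1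
      refine .comm h_i (s j * (s i * G)) ?_ ?_
      · rw [hsi.mul, hsj.mul]
      · exact slide_mul hij.symm _
    cases hbc with
    | ss hjk =>
      rename_i k
      rcases eq_or_adj_or_far i k with rfl | hik | hik
      · exact absurd hij hjk.symm.not_adj
      · exact cube_mid_xss H hij hik hjk hN hB
      · exact absurd ⟨hik, hjk⟩ hac
    | sx hjk =>
      rename_i k
      rcases eq_or_ne j k with rfl | hne
      · exact (cube_same_xsx H hij hN hB).elim
      replace hjk := far_of_not_adj hjk hne
      rcases eq_or_adj_or_far i k with rfl | hik | hik
      · exact absurd hij hjk.symm.not_adj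
      · exact (cube_mid_xsx H hij hik hjk hN hB).elim
      · exact absurd ⟨hik, hjk⟩ hac

/-- If either link is a commutation, `trans_comm` applies, up to reversal. If both links are
adjacent, the outer indices coincide or are far apart, as a path has no triangle. -/
theorem IsLcm.trans {N : ℕ} (H : LcmBelow n N) {a b c : SingularLetter n}
    {A B D : PosSingularBraidMonoid n} (hab : IsLcm a b A B) (hbc : IsLcm b c B D)
    (hN : len B ≤ N) : IsLcm a c A D := by
  cases hbc with
  | refl _ h => exact h ▸ hab
  | comm hbc E hB hD => exact hD ▸ hab.trans_comm H hbc hN hB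
  | @ss j k hjk _ _ E hB hD =>
    cases hab with
    | refl _ h => exact .ss hjk E (h.trans hB) hD
    | comm hab C hA hB' =>
      exact hA ▸ ((IsLcm.ss hjk E hB hD).symm.trans_comm H hab.symm hN hB').symm
    | @ss i _ hij _ _ C hA hB' =>
      subst hA hB' hD
      rcases eq_or_ne i k with rfl | hne
      · exact .refl _ (by rw [H.cancel (by simp only [len_gen_mul] at hN ⊢; omega) (H.cancel
            (by simp only [len_gen_mul] at hN ⊢; omega) hB)])
      · have hik := far_of_adj_adj hij hjk hne
        exact cube_far_sss H hij hjk hik hN (hB ▸ hN) hB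
    | @xs i _ hij _ _ C hA hB' =>
      subst hA hB' hD
      rcases eq_or_ne i k with rfl | hne
      · exact (cube_pair H hij (hB ▸ hN) hB.symm).symm
      · have hik := far_of_adj_adj hij hjk hne
        exact cube_far_xss H hij hjk hik hN (hB ▸ hN) hB
  | @sx j k hjk _ _ E hB hD =>
    cases hab with
    | refl _ h => exact .sx hjk E (h.trans hB) hD
    | comm hab C hA hB' =>
      exact hA ▸ ((IsLcm.sx hjk E hB hD).symm.trans_comm H hab.symm hN hB').symm
    | @ss i _ hij _ _ C hA hB' =>
      subst hA hB' hD
      rcases eq_or_ne i k with rfl | hne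
      · exact cube_pair H hij hN hB
      · have hik := far_of_adj_adj hij hjk hne
        exact (cube_far_xss H hjk.symm hij.symm hik.symm (hB ▸ hN) hN hB.symm).symm
    | @xs i _ hij _ _ C hA hB' =>
      subst hA hB' hD
      rcases eq_or_ne i k with rfl | hne
      · exact .refl _ (by rw [H.cancel (by simp only [len_gen_mul] at hN ⊢; omega) (H.cancel
            (by simp only [len_gen_mul] at hN ⊢; omega) hB)])
      · have hik := far_of_adj_adj hij hjk hne
        exact cube_far_xsx H hij hjk hik hN (hB ▸ hN) hB
  | @xs j k hjk _ _ E hB hD =>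
    cases hab with
    | refl _ h => exact .xs hjk E (h.trans hB) hD
    | comm hab C hA hB' =>
      exact hA ▸ ((IsLcm.xs hjk E hB hD).symm.trans_comm H hab.symm hN hB').symm
    | @sx i _ hij _ _ C hA hB' =>
      subst hA hB' hD
      rcases eq_or_ne i k with rfl | hne
      · exact .refl _ (by rw [H.cancel (by simp only [len_gen_mul] at hN ⊢; omega) (H.cancel
            (by simp only [len_gen_mul] at hN ⊢; omega) hB)])
      · have hik := far_of_adj_adj hij hjk hne
        exact cube_far_sxs H hij hjk hik hN (hB ▸ hN) hB

/-! ### From derivations between words to least common multiples. -/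

theorem eval_eq_eval_iff {A B : Word n} : eval A = eval B ↔ ConGen.Rel (Rel n) A B :=
  Con.eq _

theorem exists_eval (A : PosSingularBraidMonoid n) : ∃ w : Word n, eval w = A :=
  Con.mk'_surjective A

theorem len_eval (w : Word n) : len (eval w) = w.length := by
  induction w using FreeMonoid.inductionOn' with
  | one => rfl
  | of_mul a w ih =>
    rw [eval_mul, FreeMonoid.length_mul, FreeMonoid.length_of, ← ih, add_comm]
    exact len_gen_mul a _

theorem of_mul_inj {a b : SingularLetter n} {A B : Word n} :
    FreeMonoid.of a * A = FreeMonoid.of b * B ↔ a = b ∧ A = B :=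
  List.cons_eq_cons

theorem eq_one_or_eq_of_mul (w : Word n) : w = 1 ∨ ∃ a A, w = FreeMonoid.of a * A := by
  induction w using FreeMonoid.inductionOn' with
  | one => exact .inl rfl
  | of_mul a w _ => exact .inr ⟨a, w, rfl⟩

theorem length_eq_of_conGen {u v : Word n} (h : ConGen.Rel (Rel n) u v) : u.length = v.length := by
  rw [← len_eval, ← len_eval, eval_eq_eval_iff.2 h]

theorem isLcm_of_rel {a b : SingularLetter n} {A B : Word n}
    (h : Rel n (FreeMonoid.of a * A) (FreeMonoid.of b * B)) : IsLcm a b (eval A) (eval B) := by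
  generalize hu : FreeMonoid.of a * A = u at h
  generalize hv : FreeMonoid.of b * B = v at h
  cases h <;> simp only [σ, χ, mul_assoc, of_mul_inj] at hu hv <;>
    obtain ⟨rfl, rfl⟩ := hu <;> obtain ⟨rfl, rfl⟩ := hv
  case sigma_comm i j h =>
    exact .comm (.ss (by unfold Far; rw [lt_abs] at h; omega)) 1 (mul_one _).symm (mul_one _).symm
  case x_comm i j h =>
    exact .comm (.xx (by unfold Far; rw [lt_abs] at h; omega)) 1 (mul_one _).symm (mul_one _).symm
  case x_sigma_comm i j h =>
    refine .comm (.xs ?_) 1 (mul_one _).symm (mul_one _).symm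
    rw [Ne, abs_eq zero_le_one] at h
    unfold Adj
    omega
  case braid i j h => exact .ss (.inl h) 1 rfl rfl
  case slide_up i j h => exact .sx (.inl h) 1 rfl rfl
  case slide_down i j h => exact .sx (.inr h) 1 rfl rfl

theorem isLcm_of_conGen {N : ℕ} (H : LcmBelow n N) {u v : Word n} (h : ConGen.Rel (Rel n) u v)
    (hN : u.length ≤ N + 1) : ∀ {a b : SingularLetter n} {A B : Word n},
    u = FreeMonoid.of a * A → v = FreeMonoid.of b * B → IsLcm a b (eval A) (eval B) := by
  induction h with
  | of u v h =>
    rintro a b A B rfl rfl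
    exact isLcm_of_rel h
  | refl u =>
    rintro a b A B rfl h
    obtain ⟨rfl, rfl⟩ := of_mul_inj.1 h
    exact .refl _ rfl
  | symm h ih =>
    intro a b A B hu hv
    exact (ih (by rwa [length_eq_of_conGen h]) hv hu).symm
  | @trans u v w h h' ih ih' =>
    rintro a b A B hu hw
    have hl := length_eq_of_conGen h
    -- Length preservation makes the middle word nonempty, and removing its first letter leaves
    -- length at most `N`, as `IsLcm.trans` requires.
    rcases eq_one_or_eq_of_mul v with rfl | ⟨c, D, rfl⟩
    · simp [hu] at hl
    · rw [hl] at hN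
      refine (ih (hl ▸ hN) hu rfl).trans H (ih' hN rfl hw) ?_
      rw [FreeMonoid.length_mul, FreeMonoid.length_of] at hN
      rw [len_eval]
      omega
  | @mul u u' v v' h h' ih ih' =>
    intro a b A B hu hv
    have hl := length_eq_of_conGen h
    rw [FreeMonoid.length_mul] at hN
    rcases eq_one_or_eq_of_mul u with rfl | ⟨c, D, rfl⟩
    · obtain rfl : u' = 1 := FreeMonoid.length_eq_zero.1 (by simpa using hl.symm)
      rw [one_mul] at hu hv
      exact ih' (by omega) hu hv
    · rcases eq_one_or_eq_of_mul u' with rfl | ⟨d, D', rfl⟩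
      · simp at hl
      · rw [mul_assoc, of_mul_inj] at hu hv
        obtain ⟨rfl, rfl⟩ := hu
        obtain ⟨rfl, rfl⟩ := hv
        rw [eval_mul, eval_mul, eval_eq_eval_iff.2 h']
        exact (ih (by omega) rfl rfl).mul_right _

/-- Letters have conditional least common multiples in `SB_n⁺`, given by the defining relations;
in particular `SB_n⁺` is left cancellative. -/
theorem lcmBelow (n N : ℕ) : LcmBelow n N := by
  induction N with
  | zero => intro a b A B h; omega
  | succ N H =>
    intro a b A B hN h
    obtain ⟨A, rfl⟩ := exists_eval A
    obtain ⟨B, rfl⟩ := exists_eval B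
    refine isLcm_of_conGen H (eval_eq_eval_iff.1 h) ?_ rfl rfl
    rw [len_eval] at hN
    rw [FreeMonoid.length_mul, FreeMonoid.length_of]
    omega

/-! ### Divisibility of `Δ` by each `σ_i`. -/

theorem eval_Pi_succ (t : ℕ) (ht : t < n - 1) :
    eval (Pi n (t + 1)) = eval (Pi n t) * s ⟨t, ht⟩ := by
  unfold Pi
  rw [List.take_succ_eq_append_getElem (by simpa using ht)]
  simp [eval_mul, eval_σ]

theorem Pi_zero : Pi n 0 = 1 := by simp [Pi]

theorem s_comm_of_far {i j : Fin (n - 1)} (h : Far i j) : s i * s j = s j * s i := by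
  simpa using s_mul_s_of_far h 1

/-- With zero-based indices `Π_t` uses only indices below `t`, so `t < i` leaves a gap of at least
two. -/
theorem s_comm_eval_Pi (t : ℕ) (i : Fin (n - 1)) (h : t < i) :
    s i * eval (Pi n t) = eval (Pi n t) * s i := by
  induction t with
  | zero => rw [Pi_zero]; exact (mul_one _).trans (one_mul _).symm
  | succ t ih =>
    rw [eval_Pi_succ t (by omega), ← mul_assoc, ih (by omega), mul_assoc, mul_assoc,
      s_comm_of_far]
    right; exact h

/-- Conjugation by `Π_t` shifts the generators `σ_i`. -/
theorem eval_Pi_mul_s (t : ℕ) (i j : Fin (n - 1)) (hij : (j : ℕ) = i + 1) (h : (j : ℕ) < t)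
    (ht : t ≤ n - 1) : eval (Pi n t) * s i = s j * eval (Pi n t) := by
  induction t with
  | zero => omega
  | succ t ih =>
    rw [eval_Pi_succ t (by omega)]
    rcases Nat.lt_succ_iff_lt_or_eq.1 h with h | rfl
    · rw [mul_assoc, s_comm_of_far (.inr (by exact (by omega : (i : ℕ) + 1 < t))), ← mul_assoc,
        ih h (by omega), mul_assoc]
    -- Here `Π_t` with its next letter ends in `σ_i σ_j`: the braid relation turns `σ_i σ_j σ_i`
    -- into `σ_j σ_i σ_j`, and the leading `σ_j` moves left through `Π_i`.
    · have hi := eval_Pi_succ (n := n) i i.2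
      rw [← hij] at hi
      have hb := braid_mul (n := n) (.inl hij : Adj i j) 1
      rw [mul_one, mul_one] at hb
      rw [hi, mul_assoc, mul_assoc]
      change eval (Pi n i) * (s i * (s j * s i)) = s j * (eval (Pi n i) * s i * s j)
      rw [hb, ← mul_assoc, ← s_comm_eval_Pi i j (by omega), mul_assoc, mul_assoc]

/-- The word `Π_t Π_{t-1} ⋯ Π_1`. -/
def partialDelta (n t : ℕ) : Word n := ((List.range t).reverse.map fun t => Pi n (t + 1)).prod

theorem partialDelta_succ (t : ℕ) : partialDelta n (t + 1) = Pi n (t + 1) * partialDelta n t := by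
  simp [partialDelta, List.range_succ]

/-- Index zero is the first letter of the leading `Π`. Any other `σ_i` arises from its predecessor,
which divides the remaining product, by moving it through the leading `Π`. -/
theorem s_dvd_partialDelta (t : ℕ) (ht : t ≤ n - 1) (i : Fin (n - 1)) (h : (i : ℕ) < t) :
    s i ∣ eval (partialDelta n t) := by
  induction t generalizing i with
  | zero => omega
  | succ t ih =>
    rw [partialDelta_succ, eval_mul]
    rcases Nat.eq_zero_or_pos (i : ℕ) with h0 | h0
    · refine Dvd.dvd.mul_right ?_ _
      clear h ih
      induction t with
      | zero =>
        rw [eval_Pi_succ 0 (by omega), Pi_zero]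
        have hi : ⟨0, ht⟩ = i := Fin.ext h0.symm
        rw [hi]
        exact ⟨1, (one_mul _).trans (mul_one _).symm⟩
      | succ t ih =>
        rw [eval_Pi_succ (t + 1) (by omega)]
        exact (ih (by omega)).mul_right _
    · let k : Fin (n - 1) := ⟨i - 1, by omega⟩
      have hk : (i : ℕ) = k + 1 := (Nat.sub_add_cancel h0).symm
      obtain ⟨D, hD⟩ := ih (by omega) k (by omega)
      exact ⟨eval (Pi n (t + 1)) * D, by
        rw [hD, ← mul_assoc, eval_Pi_mul_s (t + 1) k i hk h ht, mul_assoc]⟩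

theorem s_dvd_eval_Delta (i : Fin (n - 1)) : s i ∣ eval (Delta n) :=
  s_dvd_partialDelta (n - 1) le_rfl i i.2

/-! ### The dichotomy and the theorem. -/

theorem eq_one_or_eq_mul_gen (A : PosSingularBraidMonoid n) :
    A = 1 ∨ ∃ A' a, A = A' * gen a := by
  obtain ⟨w, rfl⟩ := exists_eval A
  induction w using FreeMonoid.inductionOn' with
  | one => exact .inl rfl
  | of_mul a w ih =>
    right
    rcases ih with ih | ⟨A', b, ih⟩
    · exact ⟨1, a, by rw [eval_mul, ih, mul_one, one_mul]; rfl⟩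
    · exact ⟨gen a * A', b, by rw [eval_mul, ih, ← mul_assoc]; rfl⟩

/-- If `Δ` divides `A B` on the left, then `σ_i` divides `A` on the right or `B` on the left. -/
theorem exists_eq_mul_s_or_s_dvd (N : ℕ) (A : PosSingularBraidMonoid n) (hA : len A ≤ N)
    (i : Fin (n - 1)) :
    (∃ A', A = A' * s i) ∨ ∀ B, eval (Delta n) ∣ A * B → s i ∣ B := by
  induction N using Nat.strong_induction_on generalizing A i with
  | _ N ih =>
  rcases eq_one_or_eq_mul_gen A with rfl | ⟨A, a, rfl⟩
  · refine .inr fun B hB => (s_dvd_eval_Delta i).trans ?_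
    rwa [one_mul] at hB
  rw [len_mul, len_gen] at hA
  -- If the last letter commutes with `σ_i`, a final `σ_i` of `A` moves past it to the right, and a
  -- `σ_i` dividing `a B` already divides `B`.
  have hcomm : Commuting (.sigma i) a →
      (∃ A', A * gen a = A' * s i) ∨ ∀ B, eval (Delta n) ∣ A * gen a * B → s i ∣ B := by
    intro h
    rcases ih (N - 1) (by omega) A (by omega) i with ⟨A', rfl⟩ | hdvd
    · refine .inl ⟨A' * gen a, ?_⟩
      simpa only [mul_one, mul_assoc] using congrArg (A' * ·) (h.mul 1)
    · refine .inr fun B hB => ?_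
      obtain ⟨C, hC⟩ := hdvd (gen a * B) (by rwa [← mul_assoc])
      obtain ⟨D, -, rfl⟩ := (lcmBelow n _).comm h (Nat.lt_succ_self _) hC.symm
      exact ⟨D, rfl⟩
  cases a with
  | sigma j =>
    rcases eq_or_adj_or_far i j with rfl | hij | hij
    · exact .inl ⟨A, rfl⟩
    · rcases ih (N - 1) (by omega) A (by omega) i with ⟨A, rfl⟩ | hdvd
      · rw [len_mul, len_gen] at hA
        -- With `σ_i` split off, the induction hypothesis is used for `j`: a further `σ_j` completes
        -- a braid relation ending in `σ_i`; otherwise `σ_j` divides `σ_i σ_j B`, which forces `σ_i`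
        -- to divide `B`.
        rcases ih (N - 2) (by omega) A (by omega) j with ⟨A, rfl⟩ | hdvd
        · refine .inl ⟨A * s i * s j, ?_⟩
          simpa only [mul_one, mul_assoc] using congrArg (A * ·) (braid_mul hij.symm 1)
        · refine .inr fun B hB => ?_
          obtain ⟨C, hC⟩ := hdvd (s i * (s j * B)) (by simpa only [mul_assoc] using hB)
          obtain ⟨D, hD, -⟩ := (lcmBelow n _).ss hij (Nat.lt_succ_self _) hC
          exact ⟨D, (lcmBelow n _).cancel (Nat.lt_succ_self _) hD⟩
      · refine .inr fun B hB => ?_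
        obtain ⟨C, hC⟩ := hdvd (s j * B) (by rwa [← mul_assoc])
        obtain ⟨D, -, rfl⟩ := (lcmBelow n _).ss hij (Nat.lt_succ_self _) hC.symm
        exact ⟨s j * D, rfl⟩
    · exact hcomm (.ss hij)
  | x j =>
    by_cases hij : Adj i j
    · rcases ih (N - 1) (by omega) A (by omega) i with ⟨A, rfl⟩ | hdvd
      · rw [len_mul, len_gen] at hA
        rcases ih (N - 2) (by omega) A (by omega) j with ⟨A, rfl⟩ | hdvd
        · refine .inl ⟨A * x i * s j, ?_⟩
          simpa only [mul_one, mul_assoc] using congrArg (A * ·) (slide_mul hij.symm 1)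
        · refine .inr fun B hB => ?_
          obtain ⟨C, hC⟩ := hdvd (s i * (x j * B)) (by simpa only [mul_assoc] using hB)
          -- Now `x_j B = σ_j σ_i D`. Commuting `x_j` with `σ_j` gives `B = σ_j E` and `σ_i D = x_j
          -- E`, so `E` begins with `σ_i σ_j` and the braid relation brings `σ_i` to the front of
          -- `B`.
          obtain ⟨D, hD, -⟩ := (lcmBelow n _).ss hij (Nat.lt_succ_self _) hC
          obtain ⟨E, rfl, hE⟩ :=
            (lcmBelow n _).comm (.xs (not_adj_self j)) (Nat.lt_succ_self _) hD
          obtain ⟨F, -, rfl⟩ := (lcmBelow n _).sx hij (Nat.lt_succ_self _) hE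
          exact ⟨s j * (s i * F), (braid_mul hij F).symm⟩
      · refine .inr fun B hB => ?_
        obtain ⟨C, hC⟩ := hdvd (x j * B) (by rwa [← mul_assoc])
        obtain ⟨D, -, rfl⟩ := (lcmBelow n _).sx hij (Nat.lt_succ_self _) hC.symm
        exact ⟨s j * D, rfl⟩
    · exact hcomm (.sx hij)

end SingularBraid

theorem mainTheorem8 (n : ℕ) (W V : SingularBraid.Word n)
    (hW : SingularBraid.PosEq W (SingularBraid.Delta n * V)) :
    ∀ c ∈ (SingularBraid.cayleyDiagram W).nodes, ∀ i : Fin (n - 1),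
      (SingularBraid.cayleyDiagram W).IncidentWith c (SingularLetter.sigma i) := by
  open SingularBraid in
  rintro c ⟨P, Q, hPQ, rfl⟩ i
  -- The first alternative gives an edge ending at the node, the second an edge starting there.
  rcases exists_eq_mul_s_or_s_dvd _ (eval P) le_rfl i with ⟨A, hA⟩ | hdvd
  · obtain ⟨P', rfl⟩ := exists_eval A
    refine .inr ⟨eval P', P', Q, .sigma i, ?_, by rw [hA]; rfl⟩
    refine Eq.trans ?_ hPQ
    change eval P' * s i * eval Q = eval P * eval Q
    rw [hA]
  · obtain ⟨C, hC⟩ := hdvd (eval Q) ⟨eval V, hPQ.trans hW⟩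
    obtain ⟨Q', rfl⟩ := exists_eval C
    refine .inl ⟨_, P, Q', .sigma i, ?_, rfl⟩
    refine Eq.trans ?_ hPQ
    change eval P * s i * eval Q' = eval P * eval Q
    rw [hC, mul_assoc]
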